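/- Let $\mathcal M=(S,\mathrm{Act},P)$ be a finite Markov decision process: $S$ and $\mathrm{Act}$ are finite, $P\colon S\times \mathrm{Act}\times S\to[0,1]$ satisfies $\sum_{s'}P(s,a,s')\in\{0,1\}$ for all $s,a$, and for every $s$ the set $\mathrm{Act}(s)=\{a : \sum_{s'}P(s,a,s')=1\}$ of enabled actions is nonempty. Put $\mathrm{Post}(s,a)=\{s' : P(s,a,s')>0\}$. Let $T\subseteq S$ be a set of target states and $\mathrm{rew}\colon S\to\mathbb R_{\ge0}$ a reward function. A strategy is a map $\sigma\colon S\to\mathrm{Act}$ with $\sigma(s)\in\mathrm{Act}(s)$ for all $s$. Let $\mathbb E^\sigma_s(\Diamond T)\in[0,\infty]$ be the expected value, in the Markov chain with transition probabilities $P(s,\sigma(s),s')$ started in $s$, of the random variable that maps a path $s_0s_1\ldots$ to $\sum_{k<n}\mathrm{rew}(s_k)$ with $n=\min\{i : s_i\in T\}$ if the path visits $T$, and to $\infty$ otherwise. Let $\mathbb E^{\min}_s(\Diamond T)=\min_\sigma\mathbb E^\sigma_s(\Diamond T)$. For $x\colon S\to[0,\infty]$ and $r\colon S\to\mathbb N\cup\{\infty\}$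 define (with $p\cdot\infty=\infty$ for $p>0$ and $\min\emptyset=\infty$) $$\mathcal E^{\min}(x)(s)=\begin{cases}0 & s\in T\\ \mathrm{rew}(s)+\min_{a\in\mathrm{Act}(s)}\sum_{s'\in\mathrm{Post}(s,a)}P(s,a,s')\,x(s') & s\notin T,\end{cases}$$ $$\mathrm{Act}^{\downarrow x}(s)=\Big\{a\in\mathrm{Act}(s) : x(s)\ge \mathrm{rew}(s)+\sum_{s'\in\mathrm{Post}(s,a)}P(s,a,s')\,x(s')\Big\},$$ $$\mathcal D^{\min}_x(r)(s)=\begin{cases}0 & s\in T\\ 1+\min_{a\in\mathrm{Act}^{\downarrow x}(s)}\ \min_{s'\in\mathrm{Post}(s,a)}r(s') & s\notin T.\end{cases}$$ Suppose that (1) $\mathcal D^{\min}_x(r)\le r$, (2) $\mathcal E^{\min}(x)\le x$ (both pointwise), and (3) for all $s\in S$, $x(s)<\infty$ implies $r(s)<\infty$. Then $\mathbb E^{\min}_s(\Diamond T)\le x(s)$ for all $s\in S$. Moreover, there is a strategy $\sigma$ such that $$\sigma(s)\in\operatorname*{arg\,min}_{a\in\mathrm{Act}^{\downarrow x}(s)}\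 \min_{s'\in\mathrm{Post}(s,a)}r(s')\qquad\text{for all } s\in S\setminus T,$$ and every such strategy satisfies $\mathbb E^\sigma_s(\Diamond T)\le x(s)$ for all $s\in S$. -/

import Mathlib

open MeasureTheory ProbabilityTheory
open scoped NNReal ENNReal

/-- A finite Markov decision process with state space `S` and set of actions `A`. The values of `P`
are automatically at most `1`, since they are nonnegative and sum up to `0` or `1`. -/
structure MDP (S A : Type*) [Fintype S] [Fintype A] where
  /-- The transition probability function. -/
  P : S → A → S → ℝ≥0
  sum_eq_zero_or_one : ∀ s a, ∑ s', P s a s' = 0 ∨ ∑ s', P s a s' = 1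
  exists_enabled : ∀ s, ∃ a, ∑ s', P s a s' = 1

namespace MDP

variable {S A : Type*} [Fintype S] [Fintype A]

/-- The set of enabled actions of the state `s`. -/
def act (M : MDP S A) (s : S) : Set A := {a | ∑ s', M.P s a s' = 1}

/-- The set of `a`-successors of the state `s`. -/
noncomputable def post (M : MDP S A) (s : S) (a : A) : Finset S :=
  Finset.univ.filter (fun s' => 0 < M.P s a s')

/-- Memoryless deterministic strategies. -/
def Strategy (M : MDP S A) : Type _ := {σ : S → A // ∀ s, σ s ∈ M.act s}

/-! ### Expected rewards -/

/-- The distribution of the successor of `s` in the Markov chain induced by the strategy `σ`. -/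
noncomputable def stepPMF (M : MDP S A) (σ : M.Strategy) (s : S) : PMF S :=
  PMF.ofFintype (fun s' => (M.P s (σ.1 s) s' : ℝ≥0∞)) (by
    have h : ∑ s', M.P s (σ.1 s) s' = 1 := σ.2 s
    exact_mod_cast h)

section Paths

variable [MeasurableSpace S] [DiscreteMeasurableSpace S]

/-- The transition kernel of the Markov chain induced by the strategy `σ`. -/
noncomputable def stepKernel (M : MDP S A) (σ : M.Strategy) : Kernel S S where
  toFun s := (M.stepPMF σ s).toMeasure
  measurable' := Measurable.of_discrete

instance (M : MDP S A) (σ : M.Strategy) : IsMarkovKernel (M.stepKernel σ) :=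
  ⟨fun s => inferInstanceAs (IsProbabilityMeasure (M.stepPMF σ s).toMeasure)⟩

/-- The kernel that draws the state at time `n + 1` given the states up to time `n`: it only looks
at the last of these states. -/
noncomputable def historyKernel (M : MDP S A) (σ : M.Strategy) (n : ℕ) :
    Kernel ((i : Finset.Iic n) → (fun _ : ℕ => S) i) S :=
  (M.stepKernel σ).comap (fun h => h ⟨n, Finset.mem_Iic.mpr le_rfl⟩) (measurable_pi_apply _)

instance (M : MDP S A) (σ : M.Strategy) (n : ℕ) : IsMarkovKernel (M.historyKernel σ n) := by
  unfold historyKernel; infer_instance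

/-- The probability measure on infinite paths of the Markov chain induced by `σ` with initial
state `s`. -/
noncomputable def pathMeasure (M : MDP S A) (σ : M.Strategy) (s : S) : Measure (ℕ → S) :=
  Kernel.traj (X := fun _ => S) (M.historyKernel σ) 0 (fun _ => s)

end Paths

open Classical in
/-- The reward collected by an infinite path until it reaches `T` for the first time, where the
reward of a state is collected when the state is left (so the first target state on the path does
not contribute); it is `∞` if the path never reaches `T`. -/
noncomputable def rewardUntil (rew : S → ℝ≥0) (T : Set S) (w : ℕ → S) : ℝ≥0∞ :=
  if ∃ i, w i ∈ T then ∑ k ∈ Finset.range (sInf {i | w i ∈ T}), (rew (w k) : ℝ≥0∞) else ∞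

/-- The expected reward until reaching `T` from `s` under the strategy `σ`. -/
noncomputable def expReward [MeasurableSpace S] [DiscreteMeasurableSpace S] (M : MDP S A)
    (rew : S → ℝ≥0) (T : Set S) (σ : M.Strategy) (s : S) : ℝ≥0∞ :=
  ∫⁻ w, rewardUntil rew T w ∂(M.pathMeasure σ s)

/-- The minimal expected reward until reaching `T` from `s`. -/
noncomputable def minExpReward [MeasurableSpace S] [DiscreteMeasurableSpace S] (M : MDP S A)
    (rew : S → ℝ≥0) (T : Set S) (s : S) : ℝ≥0∞ :=
  ⨅ σ : M.Strategy, M.expReward rew T σ s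

/-! ### Operators -/

/-- The one-step value `rew s + ∑ s' ∈ post s a, P s a s' * x s'` of the action `a` in `s`. -/
noncomputable def actionValue (M : MDP S A) (rew : S → ℝ≥0) (x : S → ℝ≥0∞) (s : S) (a : A) :
    ℝ≥0∞ :=
  rew s + ∑ s' ∈ M.post s a, (M.P s a s' : ℝ≥0∞) * x s'

open Classical in
/-- The minimizing Bellman operator for expected rewards. -/
noncomputable def bellmanMin (M : MDP S A) (rew : S → ℝ≥0) (T : Set S) (x : S → ℝ≥0∞) :
    S → ℝ≥0∞ := fun s =>
  if s ∈ T then 0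
  else rew s + ⨅ a ∈ M.act s, ∑ s' ∈ M.post s a, (M.P s a s' : ℝ≥0∞) * x s'

/-- The set of `x`-decreasing actions of the state `s`. -/
def decreasingAct (M : MDP S A) (rew : S → ℝ≥0) (x : S → ℝ≥0∞) (s : S) : Set A :=
  {a | a ∈ M.act s ∧ M.actionValue rew x s a ≤ x s}

open Classical in
/-- The minimizing distance operator, restricted to `x`-decreasing actions (the minimum over the
empty set is `∞`). -/
noncomputable def decreasingDistMin (M : MDP S A) (rew : S → ℝ≥0) (T : Set S) (x : S → ℝ≥0∞)
    (r : S → ℕ∞) : S → ℕ∞ := fun s =>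
  if s ∈ T then 0
  else 1 + ⨅ a ∈ M.decreasingAct rew x s, ⨅ s' ∈ M.post s a, r s'

/-- The strategy `σ` is extracted from `(x, r)`: in each state outside `T`, it picks, among the
`x`-decreasing actions, one that minimizes the least rank of a successor. -/
def IsExtracted (M : MDP S A) (rew : S → ℝ≥0) (T : Set S) (x : S → ℝ≥0∞) (r : S → ℕ∞)
    (σ : M.Strategy) : Prop :=
  ∀ s, s ∉ T → σ.1 s ∈ M.decreasingAct rew x s ∧
    ∀ a ∈ M.decreasingAct rew x s,
      (⨅ s' ∈ M.post s (σ.1 s), r s') ≤ (⨅ s' ∈ M.post s a, r s')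

end MDP

/-! Let `σ` be extracted. It only picks `x`-decreasing actions, so `x` drops by `rew` in expectation
along each step outside `T`; telescoping (`lintegral_tsum_avoidSet_le`) bounds the expected reward
collected before `T` by `x s`. This says nothing about paths that miss `T`, whose value is `∞`, so
`T` must be reached almost surely whenever `x s < ∞`.

Ranks supply this. Outside `T`, a state with `x < ∞` has finite rank, some successor of smaller
rank, and only successors with `x < ∞`. For small `β > 0` the bounded potential `1 - β ^ rank`
therefore drops by a fixed positive amount in expectation (`pow_add_sum_le`). The same telescoping
lemma then makes the expected number of steps before `T` finite. -/

namespace MDP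

section AvoidSet

variable {S : Type*}

/-- The paths whose first `n` states all lie outside `T`. -/
def avoidSet (T : Set S) (n : ℕ) : Set (ℕ → S) := {w | ∀ i < n, w i ∉ T}

lemma measurableSet_avoidSet [MeasurableSpace S] [DiscreteMeasurableSpace S] (T : Set S) (n : ℕ) :
    MeasurableSet (avoidSet T n) := by
  have : avoidSet T n = ⋂ i, ⋂ (_ : i < n), (fun w : ℕ → S => w i) ⁻¹' Tᶜ := by
    ext w; simp [avoidSet]
  rw [this]
  exact .iInter fun i => .iInter fun _ => measurable_pi_apply i (MeasurableSet.of_discrete)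

lemma measurable_comp_apply [MeasurableSpace S] [DiscreteMeasurableSpace S] (y : S → ℝ≥0∞)
    (n : ℕ) : Measurable fun w : ℕ → S => y (w n) :=
  (Measurable.of_discrete (f := y)).comp (measurable_pi_apply n)

/-- Lets a finite expectation of this sum rule out, almost surely, paths that never reach `T`. -/
lemma tsum_avoidSet_eq_top {T : Set S} {w : ℕ → S} (hw : ∀ i, w i ∉ T) {c : ℝ≥0∞} (hc : c ≠ 0) :
    ∑' k, (avoidSet T (k + 1)).indicator (fun _ => c) w = ∞ := by
  have : ∀ k, w ∈ avoidSet T (k + 1) := fun k i _ => hw i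
  simp [this, ENNReal.tsum_const_eq_top_of_ne_zero hc]

lemma rewardUntil_le_tsum (rew : S → ℝ≥0) {T : Set S} {w : ℕ → S} (hw : ∃ i, w i ∈ T) :
    rewardUntil rew T w ≤
      ∑' k, (avoidSet T (k + 1)).indicator (fun w => (rew (w k) : ℝ≥0∞)) w := by
  rw [rewardUntil, if_pos hw]
  refine le_trans (le_of_eq ?_) (ENNReal.sum_le_tsum (Finset.range (sInf {i | w i ∈ T})))
  refine Finset.sum_congr rfl fun k hk => ?_
  rw [Set.indicator_of_mem]
  intro i hi hiT
  have h1 : sInf {i | w i ∈ T} ≤ i := Nat.sInf_le hiT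
  have h2 := Finset.mem_range.1 hk
  omega

end AvoidSet

variable {S A : Type*} [Fintype S] [Fintype A]

lemma sum_post (M : MDP S A) (s : S) (a : A) (y : S → ℝ≥0∞) :
    ∑ s' ∈ M.post s a, (M.P s a s' : ℝ≥0∞) * y s' = ∑ s', (M.P s a s' : ℝ≥0∞) * y s' := by
  refine Finset.sum_subset (Finset.subset_univ _) fun s' _ hs' => ?_
  have : M.P s a s' = 0 := by simpa [post] using hs'
  simp [this]

section Paths

variable [MeasurableSpace S] [DiscreteMeasurableSpace S]

instance (M : MDP S A) (σ : M.Strategy) (s : S) : IsProbabilityMeasure (M.pathMeasure σ s) := by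
  unfold pathMeasure; infer_instance

lemma lintegral_stepKernel (M : MDP S A) (σ : M.Strategy) (s : S) (y : S → ℝ≥0∞) :
    ∫⁻ s', y s' ∂(M.stepKernel σ s) = ∑ s', (M.P s (σ.1 s) s' : ℝ≥0∞) * y s' := by
  change ∫⁻ s', y s' ∂(M.stepPMF σ s).toMeasure = _
  rw [lintegral_fintype]
  refine Finset.sum_congr rfl fun s' _ => ?_
  rw [PMF.toMeasure_apply_singleton _ _ (measurableSet_singleton _), mul_comm]
  rfl

lemma ae_pathMeasure_zero (M : MDP S A) (σ : M.Strategy) (s : S) :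
    ∀ᵐ w ∂(M.pathMeasure σ s), w 0 = s := by
  have h : (M.pathMeasure σ s).map (Preorder.frestrictLe 0) = Measure.dirac (fun _ => s) := by
    rw [pathMeasure, Kernel.traj_map_frestrictLe_apply, Kernel.partialTraj_self, Kernel.id_apply]
  have h2 : ∀ᵐ u ∂((M.pathMeasure σ s).map (Preorder.frestrictLe (π := fun _ => S) 0)),
      u ⟨0, by simp⟩ = s := by
    rw [h, ae_dirac_iff]
    exact measurableSet_eq_fun (measurable_pi_apply _) measurable_const
  exact ae_of_ae_map (by fun_prop) h2

/-- The Markov property: the state at time `n + 1` is distributed according to the step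
distribution of the state at time `n`, independently of the event that `T` has been avoided. -/
lemma lintegral_avoidSet_succ (M : MDP S A) (σ : M.Strategy) (T : Set S) (s : S) (n : ℕ)
    (y : S → ℝ≥0∞) :
    ∫⁻ w, (avoidSet T (n + 1)).indicator (fun w => y (w (n + 1))) w ∂(M.pathMeasure σ s) =
      ∫⁻ w, (avoidSet T (n + 1)).indicator
        (fun w => ∑ s', (M.P (w n) (σ.1 (w n)) s' : ℝ≥0∞) * y s') w ∂(M.pathMeasure σ s) := by
  let B : Set ((i : Finset.Iic n) → (fun _ : ℕ => S) i) := {u | ∀ i, u i ∉ T}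
  have hB : MeasurableSet B := by
    have : B = ⋂ i, (fun u => u i) ⁻¹' Tᶜ := by ext u; simp [B]
    rw [this]
    exact .iInter fun i => measurable_pi_apply i (MeasurableSet.of_discrete)
  have hmem : ∀ w : ℕ → S, w ∈ avoidSet T (n + 1) ↔ Preorder.frestrictLe n w ∈ B := by
    intro w
    simp [avoidSet, B]
  have hpair : Measurable fun w : ℕ → S =>
      ((Preorder.frestrictLe n w : (i : Finset.Iic n) → (fun _ : ℕ => S) i), w (n + 1)) := by
    fun_prop
  let F : ((i : Finset.Iic n) → (fun _ : ℕ => S) i) × S → ℝ≥0∞ :=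
    (B ×ˢ Set.univ).indicator fun p => y p.2
  have hF : Measurable F :=
    ((Measurable.of_discrete (f := y)).comp measurable_snd).indicator (hB.prod .univ)
  let G : ((i : Finset.Iic n) → (fun _ : ℕ => S) i) → ℝ≥0∞ :=
    fun u => ∫⁻ s', F (u, s') ∂(M.historyKernel σ n u)
  have hG : Measurable G := hF.lintegral_kernel_prod_right'
  calc ∫⁻ w, (avoidSet T (n + 1)).indicator (fun w => y (w (n + 1))) w ∂(M.pathMeasure σ s)
      = ∫⁻ w, F (Preorder.frestrictLe n w, w (n + 1)) ∂(M.pathMeasure σ s) := by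
        refine lintegral_congr fun w => ?_
        by_cases hw : w ∈ avoidSet T (n + 1)
        · simp [F, hw, (hmem w).1 hw]
        · simp [F, hw, mt (hmem w).2 hw]
    _ = ∫⁻ p, F p ∂((M.pathMeasure σ s).map fun w => (Preorder.frestrictLe n w, w (n + 1))) :=
        (lintegral_map hF hpair).symm
    _ = ∫⁻ u, G u ∂((M.pathMeasure σ s).map (Preorder.frestrictLe n)) := by
        -- The joint law of the history up to `n` and the next state is the law of the history
        -- composed with `historyKernel`.
        rw [pathMeasure, ← Kernel.partialTraj_compProd_eq_map_traj (Nat.zero_le n),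
          Kernel.traj_map_frestrictLe_apply, Measure.lintegral_compProd hF]
    _ = ∫⁻ w, G (Preorder.frestrictLe n w) ∂(M.pathMeasure σ s) :=
        lintegral_map hG (by fun_prop)
    _ = _ := by
        refine lintegral_congr fun w => ?_
        by_cases hw : w ∈ avoidSet T (n + 1)
        · have hw' := (hmem w).1 hw
          simp only [G, F, hw, Set.indicator, Set.mem_prod, hw',
            Set.mem_univ, and_self, if_true]
          exact M.lintegral_stepKernel σ (w n) y
        · simp [G, F, hw, mt (hmem w).2 hw]

/-- A function that decreases by `ρ` in expectation along each step outside `T` bounds the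
expectation of the sum of `ρ` over the states before `T` is reached. -/
lemma lintegral_tsum_avoidSet_le (M : MDP S A) (σ : M.Strategy) (T : Set S) (ρ y : S → ℝ≥0∞)
    (h : ∀ s, s ∉ T → ρ s + ∑ s', (M.P s (σ.1 s) s' : ℝ≥0∞) * y s' ≤ y s) (s : S) :
    ∫⁻ w, ∑' k, (avoidSet T (k + 1)).indicator (fun w => ρ (w k)) w ∂(M.pathMeasure σ s)
      ≤ y s := by
  have hm : ∀ (f : S → ℝ≥0∞) (k j : ℕ),
      Measurable ((avoidSet T k).indicator fun w : ℕ → S => f (w j)) := fun f k j =>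
    (measurable_comp_apply f j).indicator (measurableSet_avoidSet T k)
  -- Telescoping invariant: what was collected in the first `n` steps, plus the potential left on
  -- paths still outside `T`, never exceeds the initial potential.
  have key : ∀ n, ∑ k ∈ Finset.range n,
      ∫⁻ w, (avoidSet T (k + 1)).indicator (fun w => ρ (w k)) w ∂(M.pathMeasure σ s) +
      ∫⁻ w, (avoidSet T n).indicator (fun w => y (w n)) w ∂(M.pathMeasure σ s) ≤ y s := by
    intro n
    induction n with
    | zero =>
      have : ∫⁻ w, y (w 0) ∂(M.pathMeasure σ s) = y s := by
        rw [lintegral_congr_ae (g := fun _ => y s)]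
        · simp
        · filter_upwards [M.ae_pathMeasure_zero σ s] with w hw
          rw [hw]
      simp [avoidSet, this]
    | succ n ih =>
      refine le_trans ?_ ih
      rw [Finset.sum_range_succ, add_assoc, lintegral_avoidSet_succ,
        ← lintegral_add_left (hm ρ (n + 1) n)]
      gcongr with w
      by_cases hw : w ∈ avoidSet T (n + 1)
      · have hw' : w ∈ avoidSet T n := fun i hi => hw i (Nat.lt_succ_of_lt hi)
        simpa [hw, hw'] using h (w n) (hw n (Nat.lt_succ_self n))
      · simp [hw]
  rw [lintegral_tsum fun k => (hm ρ (k + 1) k).aemeasurable]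
  exact ENNReal.tsum_le_of_sum_range_le fun n => le_self_add.trans (key n)

/-- If some bounded function decreases by a fixed positive amount in expectation in each step
outside `T`, then every function that decreases by at least the reward is an upper bound on the
expected reward. -/
lemma expReward_le (M : MDP S A) (σ : M.Strategy) (T : Set S) (rew : S → ℝ≥0) (x y : S → ℝ≥0∞)
    {c : ℝ≥0∞} (hc : c ≠ 0)
    (hx : ∀ s, s ∉ T → rew s + ∑ s', (M.P s (σ.1 s) s' : ℝ≥0∞) * x s' ≤ x s)
    (hy : ∀ s, s ∉ T → c + ∑ s', (M.P s (σ.1 s) s' : ℝ≥0∞) * y s' ≤ y s)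
    {s : S} (hs : y s ≠ ∞) : M.expReward rew T σ s ≤ x s := by
  have hreach : ∀ᵐ w ∂(M.pathMeasure σ s), ∃ i, w i ∈ T := by
    have hlt := (M.lintegral_tsum_avoidSet_le σ T (fun _ => c) y hy s).trans_lt hs.lt_top
    have hmeas : Measurable fun w : ℕ → S =>
        ∑' k, (avoidSet T (k + 1)).indicator (fun _ => c) w :=
      Measurable.tsum fun k => measurable_const.indicator (measurableSet_avoidSet T (k + 1))
    filter_upwards [ae_lt_top hmeas hlt.ne] with w hw
    by_contra! hT
    exact hw.ne (tsum_avoidSet_eq_top hT hc)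
  refine le_trans (lintegral_mono_ae ?_)
    (M.lintegral_tsum_avoidSet_le σ T (fun s => (rew s : ℝ≥0∞)) x hx s)
  filter_upwards [hreach] with w hw
  exact rewardUntil_le_tsum rew hw

end Paths

/-- Finitely many actions are enabled, so the Bellman minimum is attained, and a minimizer is
decreasing. -/
lemma exists_mem_decreasingAct (M : MDP S A) {T : Set S} {rew : S → ℝ≥0} {x : S → ℝ≥0∞}
    (h_val : M.bellmanMin rew T x ≤ x) {s : S} (hs : s ∉ T) :
    (M.decreasingAct rew x s).Nonempty := by
  obtain ⟨a, ha, hmin⟩ := (M.act s).toFinite.exists_minimalFor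
    (fun a => ∑ s' ∈ M.post s a, (M.P s a s' : ℝ≥0∞) * x s') _ (M.exists_enabled s)
  refine ⟨a, ha, ?_⟩
  refine le_trans ?_ (h_val s)
  simp only [bellmanMin, if_neg hs, actionValue]
  gcongr
  refine le_iInf₂ fun b hb => ?_
  exact (le_total _ _).elim id fun h => hmin hb h

lemma exists_isExtracted (M : MDP S A) {T : Set S} {rew : S → ℝ≥0} {x : S → ℝ≥0∞} (r : S → ℕ∞)
    (h_val : M.bellmanMin rew T x ≤ x) : ∃ σ : M.Strategy, M.IsExtracted rew T x r σ := by
  have h : ∀ s, ∃ a ∈ M.act s, s ∉ T → a ∈ M.decreasingAct rew x s ∧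
      ∀ b ∈ M.decreasingAct rew x s,
        (⨅ s' ∈ M.post s a, r s') ≤ (⨅ s' ∈ M.post s b, r s') := by
    intro s
    by_cases hs : s ∈ T
    · obtain ⟨a, ha⟩ := M.exists_enabled s
      exact ⟨a, ha, fun h => (h hs).elim⟩
    · obtain ⟨a, ha, hmin⟩ := (M.decreasingAct rew x s).toFinite.exists_minimalFor
        (fun a => ⨅ s' ∈ M.post s a, r s') _ (M.exists_mem_decreasingAct h_val hs)
      exact ⟨a, ha.1, fun _ => ⟨ha, fun b hb => (le_total _ _).elim id fun h => hmin hb h⟩⟩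
  choose f hf hf' using h
  exact ⟨⟨f, hf⟩, hf'⟩

/-- An extracted strategy has in each state of finite rank a successor of smaller rank. -/
lemma IsExtracted.exists_rank_lt {M : MDP S A} {T : Set S} {rew : S → ℝ≥0} {x : S → ℝ≥0∞}
    {r : S → ℕ∞} {σ : M.Strategy} (hσ : M.IsExtracted rew T x r σ)
    (h_rank : M.decreasingDistMin rew T x r ≤ r) {s : S} (hs : s ∉ T) (hr : r s < ⊤) :
    ∃ s', 0 < M.P s (σ.1 s) s' ∧ r s' + 1 ≤ r s := by
  have h1 : 1 + ⨅ s' ∈ M.post s (σ.1 s), r s' ≤ r s := by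
    refine le_trans ?_ (h_rank s)
    simp only [decreasingDistMin, if_neg hs]
    gcongr
    exact le_iInf₂ (hσ s hs).2
  have h2 : ⨅ s' ∈ M.post s (σ.1 s), r s' < r s := by
    have : (1 : ℕ∞) + ⨅ s' ∈ M.post s (σ.1 s), r s' < ⊤ := h1.trans_lt hr
    refine lt_of_lt_of_le ?_ h1
    rw [add_comm]
    -- Strictness needs the infimum to be finite, which `r s < ⊤` guarantees.
    exact ENat.lt_add_one_iff (by rintro h; simp [h] at this) |>.2 le_rfl
  obtain ⟨s', hs'⟩ := iInf_lt_iff.1 h2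
  obtain ⟨hm, hlt⟩ := iInf_lt_iff.1 hs'
  exact ⟨s', by simpa [post] using hm, Order.add_one_le_of_lt hlt⟩

/-- Keeps a decreasing strategy inside the region `x < ∞`, where ranks are finite. -/
lemma lt_top_of_actionValue_lt_top {M : MDP S A} {rew : S → ℝ≥0} {x : S → ℝ≥0∞} {s s' : S} {a : A}
    (h : M.actionValue rew x s a < ∞) (hs' : 0 < M.P s a s') : x s' < ∞ := by
  rw [actionValue, sum_post] at h
  have h1 := (ENNReal.sum_lt_top.1 (le_add_self.trans_lt h)) s' (Finset.mem_univ _)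
  by_contra! hx
  rw [top_le_iff.1 hx, ENNReal.mul_top (by exact_mod_cast hs'.ne')] at h1
  exact h1.false

lemma exists_pos_forall_two_mul_le (M : MDP S A) :
    ∃ β : ℝ, 0 < β ∧ 2 * β ≤ 1 ∧ ∀ s a s', 0 < M.P s a s' → 2 * β ≤ M.P s a s' := by
  classical
  -- Inserting `1` makes the set nonempty and caps its minimum at `1`.
  let V : Finset ℝ≥0 := insert 1 ((Finset.univ.image fun p : S × A × S =>
    M.P p.1 p.2.1 p.2.2).filter (0 < ·))
  have hV : V.Nonempty := ⟨1, Finset.mem_insert_self _ _⟩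
  have hpos : 0 < V.min' hV := by
    have := V.min'_mem hV
    simp only [V, Finset.mem_insert, Finset.mem_filter] at this
    rcases this with h | h
    · exact h.symm ▸ one_pos
    · exact h.2
  refine ⟨V.min' hV / 2, by positivity, ?_, fun s a s' h => ?_⟩
  · have := V.min'_le 1 (Finset.mem_insert_self _ _)
    have : ((V.min' hV : ℝ≥0) : ℝ) ≤ 1 := by exact_mod_cast this
    linarith
  · have := V.min'_le (M.P s a s') (Finset.mem_insert_of_mem (Finset.mem_filter.2
      ⟨Finset.mem_image.2 ⟨(s, a, s'), Finset.mem_univ _, rfl⟩, h⟩))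
    have : ((V.min' hV : ℝ≥0) : ℝ) ≤ M.P s a s' := by exact_mod_cast this
    linarith

/-- If in `s` the action `a` has a successor of rank smaller than `q s`, then the function
`1 - β ^ q` decreases by at least `β ^ N` in expectation. -/
lemma pow_add_sum_le {M : MDP S A} {β : ℝ} (hβ : 0 < β) (hβ1 : 2 * β ≤ 1) {q : S → ℕ} {N : ℕ}
    {s s₀ : S} {a : A} (ha : a ∈ M.act s) (hP : 2 * β ≤ M.P s a s₀) (hq : q s₀ + 1 ≤ q s)
    (hN : q s ≤ N) :
    β ^ N + ∑ s', (M.P s a s' : ℝ) * (1 - β ^ q s') ≤ 1 - β ^ q s := by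
  have hsum : ∑ s', (M.P s a s' : ℝ) = 1 := by
    have : ∑ s', M.P s a s' = 1 := ha
    exact_mod_cast this
  have h1 : (M.P s a s₀ : ℝ) * β ^ q s₀ ≤ ∑ s', (M.P s a s' : ℝ) * β ^ q s' :=
    Finset.single_le_sum (f := fun s' => (M.P s a s' : ℝ) * β ^ q s')
      (fun _ _ => by positivity) (Finset.mem_univ s₀)
  have h2 : 2 * β * β ^ q s₀ ≤ M.P s a s₀ * β ^ q s₀ := by gcongr
  have h3 : β ^ q s ≤ β ^ (q s₀ + 1) := pow_le_pow_of_le_one hβ.le (by linarith) hq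
  have h4 : β ^ N ≤ β ^ q s := pow_le_pow_of_le_one hβ.le (by linarith) hN
  -- The factor `2` pays here: the expected `β ^ q` after the step is at least `2 * β ^ q s`, and
  -- the surplus `β ^ q s` is at least `β ^ N`.
  simp only [mul_sub, mul_one, Finset.sum_sub_distrib, hsum]
  rw [pow_succ] at h3
  linarith

lemma IsExtracted.expReward_le [MeasurableSpace S] [DiscreteMeasurableSpace S] {M : MDP S A}
    {T : Set S} {rew : S → ℝ≥0} {x : S → ℝ≥0∞} {r : S → ℕ∞} {σ : M.Strategy}
    (hσ : M.IsExtracted rew T x r σ) (h_rank : M.decreasingDistMin rew T x r ≤ r)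
    (h_fin : ∀ s, x s < ∞ → r s < ⊤) (s : S) : M.expReward rew T σ s ≤ x s := by
  classical
  rcases eq_top_or_lt_top (x s) with hxs | hxs
  · simp [hxs]
  obtain ⟨β, hβ, hβ1, hβP⟩ := M.exists_pos_forall_two_mul_le
  let q : S → ℕ := fun s => (r s).toNat
  let N := ∑ s, q s
  -- The value `∞` makes the decrease condition trivial where `x = ∞`, so the default `toNat ⊤ = 0`
  -- in `q` is never used.
  let y : S → ℝ≥0∞ := fun s => if x s < ∞ then ENNReal.ofReal (1 - β ^ q s) else ∞
  have hpow : ∀ s, 0 ≤ 1 - β ^ q s := fun s =>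
    sub_nonneg.2 (pow_le_one₀ hβ.le (by linarith))
  refine M.expReward_le σ T rew x y (c := ENNReal.ofReal (β ^ N))
    (by simpa using pow_pos hβ N) (fun s hs => ?_) (fun s hs => ?_) (by simp [y, hxs])
  · have := (hσ s hs).1.2
    rwa [actionValue, sum_post] at this
  rcases eq_top_or_lt_top (x s) with hs' | hxs
  · simp [y, hs']
  obtain ⟨s₀, hs₀, hlt⟩ := hσ.exists_rank_lt h_rank hs (h_fin s hxs)
  have hq : q s₀ + 1 ≤ q s := by
    have hr := h_fin s hxs
    have hr₀ : r s₀ ≠ ⊤ := fun h => by simp [h] at hlt; simp [hlt] at hr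
    lift r s₀ to ℕ using hr₀ with m hm
    lift r s to ℕ using hr.ne with k hk
    simp only [q, ← hm, ← hk, ENat.toNat_natCast]
    exact_mod_cast hlt
  have key := pow_add_sum_le hβ hβ1 (σ.2 s) (hβP s _ s₀ hs₀) hq
    (Finset.single_le_sum (f := q) (fun _ _ => Nat.zero_le _) (Finset.mem_univ s))
  have hsum : ∑ s', (M.P s (σ.1 s) s' : ℝ≥0∞) * y s' =
      ENNReal.ofReal (∑ s', (M.P s (σ.1 s) s' : ℝ) * (1 - β ^ q s')) := by
    rw [ENNReal.ofReal_sum_of_nonneg fun s' _ => mul_nonneg (by positivity) (hpow s')]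
    refine Finset.sum_congr rfl fun s' _ => ?_
    -- Only states of zero probability can have `y s' = ∞`, and there `0 * ∞ = 0`.
    rcases eq_or_ne (M.P s (σ.1 s) s') 0 with h0 | h0
    · simp [h0]
    · have := lt_top_of_actionValue_lt_top ((hσ s hs).1.2.trans_lt hxs) (pos_iff_ne_zero.2 h0)
      rw [ENNReal.ofReal_mul (by positivity), ENNReal.ofReal_coe_nnreal]
      simp [y, this]
  rw [hsum, ← ENNReal.ofReal_add (by positivity)
    (Finset.sum_nonneg fun s' _ => mul_nonneg (by positivity) (hpow s'))]
  simpa only [y, hxs, if_true] using ENNReal.ofReal_le_ofReal key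

end MDP

theorem mainTheorem11 {S A : Type*} [Fintype S] [Fintype A]
    [MeasurableSpace S] [DiscreteMeasurableSpace S]
    (M : MDP S A) (T : Set S) (rew : S → ℝ≥0) (x : S → ℝ≥0∞) (r : S → ℕ∞)
    (h_rank : M.decreasingDistMin rew T x r ≤ r)
    (h_val : M.bellmanMin rew T x ≤ x)
    (h_fin : ∀ s, x s < ∞ → r s < ⊤) :
    (∀ s, M.minExpReward rew T s ≤ x s) ∧
    (∃ σ : M.Strategy, M.IsExtracted rew T x r σ) ∧
    (∀ σ : M.Strategy, M.IsExtracted rew T x r σ → ∀ s, M.expReward rew T σ s ≤ x s) := by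
  have h (σ : M.Strategy) (hσ : M.IsExtracted rew T x r σ) (s : S) : M.expReward rew T σ s ≤ x s :=
    hσ.expReward_le h_rank h_fin s
  obtain ⟨σ, hσ⟩ := M.exists_isExtracted r h_val
  exact ⟨fun s => (iInf_le _ σ).trans (h σ hσ s), ⟨σ, hσ⟩, h⟩
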